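/- Let $(S,+)$ and $(R,+)$ be commutative semigroups. For $B\subseteq R$ and $t\in R$ write $B-t=\{x\in R: t+x\in B\}$. A set $B\subseteq R$ is \emph{thick} if for every finite $F\subseteq R$ there is $x\in R$ with $F+x\subseteq B$, and \emph{piecewise syndetic} if there is a finite $F\subseteq R$ such that $\bigcup_{t\in F}(B-t)$ is thick. For $r\in\mathbb{N}$, a set $E\subseteq S$ is $\mathbf{IP}_r^*$ if for all $a_1,\dots,a_r\in S$ (not necessarily distinct) there is a nonempty $I\subseteq\{1,\dots,r\}$ with $\sum_{i\in I}a_i\in E$. \textbf{Theorem.} Let $A\subseteq R$ be piecewise syndetic. Then for every $n\in\mathbb{N}$ there is $r\in\mathbb{N}$ such that for all semigroup homomorphisms $\varphi_1,\dots,\varphi_n\colon S\to R$ the set $$D(A;\varphi_1,\dots,\varphi_n)=\Big\{d\in S:\ \bigcap_{i=1}^{n}\big(A-\varphi_i(d)\big)\text{ is piecewise syndetic in }R\Big\}$$ is $\mathbf{IP}_r^*$ in $S$. -/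

import Mathlib

namespace SemigroupLargeness

/-- The setTranslate `-t + A = {x | t + x ∈ A}` (written `t⁻¹A` multiplicatively, and `A - t` in the
commutative case). -/
def setTranslate {R : Type*} [AddSemigroup R] (t : R) (A : Set R) : Set R :=
  {x | t + x ∈ A}

/-- `A` is thick if every finite set `F` has some `x` with `F + x ⊆ A`. -/
def IsThick {R : Type*} [AddSemigroup R] (A : Set R) : Prop :=
  ∀ F : Finset R, ∃ x : R, ∀ s ∈ F, s + x ∈ A

/-- `A` is piecewise syndetic if finitely many of its translates have a thick union. -/
def IsPiecewiseSyndetic {R : Type*} [AddSemigroup R] (A : Set R) : Prop :=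
  ∃ F : Finset R, IsThick (⋃ t ∈ F, setTranslate t A)

/-- The finite sums of a family `a` (repetitions allowed, i.e. of the multiset of its values): all
sums of `a` over non-empty finite sets `I` of indices. A semigroup need not have a zero, so the sum
is computed in `S` with a new zero adjoined; as `I` is non-empty, its value lies in `S`. -/
def finiteSums {S : Type*} [AddCommSemigroup S] {ι : Type*} (a : ι → S) : Set S :=
  {s | ∃ I : Finset ι, I.Nonempty ∧ ∑ i ∈ I, (a i : WithZero S) = (s : WithZero S)}

/-- `A` is `IP_r^*` if it meets the set of finite sums of every `r`-element multiset (that is, of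
every family of `r` not necessarily distinct elements). -/
def IsIPStar {S : Type*} [AddCommSemigroup S] (r : ℕ) (A : Set S) : Prop :=
  ∀ a : Fin r → S, (finiteSums a ∩ A).Nonempty

/-- `D(A; φ₁, …, φₙ)`: the set of `d` for which `⋂ᵢ (A - φᵢ(d))` is piecewise syndetic. -/
def returnSet {S R : Type*} [AddSemigroup S] [AddSemigroup R] {n : ℕ} (A : Set R)
    (φ : Fin n → (S →ₙ+ R)) : Set S :=
  {d | IsPiecewiseSyndetic (⋂ i, setTranslate (φ i d) A)}

end SemigroupLargeness

namespace SemigroupLargeness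

open Combinatorics

section Largeness

variable {R : Type*} [AddCommSemigroup R]

/-! Hales–Jewett over the alphabet `Fin n`, with the finitely many translates of `A` as colours. A
word `w` encodes the sum of the `φ (w i) (a i)`; along a line `l` this is a fixed part plus `φ j (d
l)`, where `d l` sums `a` over the active coordinates. A monochromatic line thus puts a point in a
translate of the set required at `d l`. Finitely many pairs (line, colour) occur, so partition
regularity makes one such set piecewise syndetic. -/

theorem IsThick.mono {A B : Set R} (hA : IsThick A) (h : A ⊆ B) : IsThick B := fun F =>
  (hA F).imp fun _ hx s hs => h (hx s hs)

/-- A set covered by finitely many translates of `A` is piecewise syndetic only if `A` is. -/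
theorem IsPiecewiseSyndetic.of_subset_iUnion {A B : Set R} (hB : IsPiecewiseSyndetic B)
    (F : Finset R) (h : B ⊆ ⋃ t ∈ F, setTranslate t A) : IsPiecewiseSyndetic A := by
  classical
  obtain ⟨G, hG⟩ := hB
  refine ⟨(F ×ˢ G).image fun p => p.1 + p.2, hG.mono fun x hx => ?_⟩
  simp only [Set.mem_iUnion, exists_prop] at hx ⊢
  obtain ⟨g, hg, hx⟩ := hx
  have hx' := h hx
  simp only [Set.mem_iUnion, exists_prop] at hx'
  obtain ⟨t, ht, hx'⟩ := hx'
  refine ⟨t + g, Finset.mem_image.2 ⟨(t, g), Finset.mem_product.2 ⟨ht, hg⟩, rfl⟩, ?_⟩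
  simpa [setTranslate, add_assoc] using hx'

theorem IsPiecewiseSyndetic.of_setTranslate {A : Set R} {t : R}
    (h : IsPiecewiseSyndetic (setTranslate t A)) : IsPiecewiseSyndetic A :=
  h.of_subset_iUnion {t} (by simp)

theorem not_isPiecewiseSyndetic_empty : ¬ IsPiecewiseSyndetic (∅ : Set R) := by
  rintro ⟨F, hF⟩
  obtain ⟨x, -⟩ := hF ∅
  obtain ⟨y, hy⟩ := hF {x}
  simpa [setTranslate] using hy x (by simp)

/-- If `G` has no translate inside `B`, every translate of `G` lying in `A ∪ B` meets `A`, so the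
translates of `A` by `G` have thick union. -/
theorem IsThick.isPiecewiseSyndetic_or_isThick {A B : Set R} (h : IsThick (A ∪ B)) :
    IsPiecewiseSyndetic A ∨ IsThick B := by
  classical
  by_cases hB : IsThick B
  · exact Or.inr hB
  simp only [IsThick, not_forall, not_exists] at hB
  obtain ⟨G, hG⟩ := hB
  refine Or.inl ⟨G, fun H => ?_⟩
  obtain ⟨x, hx⟩ := h ((G ×ˢ H).image fun p => p.1 + p.2)
  refine ⟨x, fun s hs => ?_⟩
  obtain ⟨g, hg, hgB⟩ := hG (s + x)
  have := hx (g + s) (Finset.mem_image.2 ⟨(g, s), Finset.mem_product.2 ⟨hg, hs⟩, rfl⟩)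
  rw [add_assoc] at this
  exact Set.mem_biUnion hg (this.resolve_right hgB)

theorem IsPiecewiseSyndetic.or_of_union {A B : Set R} (h : IsPiecewiseSyndetic (A ∪ B)) :
    IsPiecewiseSyndetic A ∨ IsPiecewiseSyndetic B := by
  obtain ⟨F, hF⟩ := h
  have hF' : IsThick ((⋃ t ∈ F, setTranslate t A) ∪ ⋃ t ∈ F, setTranslate t B) := by
    refine hF.mono fun x hx => ?_
    simp only [Set.mem_iUnion, exists_prop, Set.mem_union] at hx ⊢
    obtain ⟨t, ht, hx | hx⟩ := hx
    exacts [Or.inl ⟨t, ht, hx⟩, Or.inr ⟨t, ht, hx⟩]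
  exact hF'.isPiecewiseSyndetic_or_isThick.imp
    (fun h => h.of_subset_iUnion F subset_rfl) (fun h => ⟨F, h⟩)

/-- Piecewise syndeticity is partition regular. -/
theorem IsPiecewiseSyndetic.exists_of_biUnion {κ : Type*} {B : κ → Set R} (K : Finset κ)
    (h : IsPiecewiseSyndetic (⋃ k ∈ K, B k)) : ∃ k ∈ K, IsPiecewiseSyndetic (B k) := by
  classical
  induction K using Finset.induction_on with
  | empty => exact absurd (by simpa using h) not_isPiecewiseSyndetic_empty
  | insert k K _ ih =>
    rw [Finset.set_biUnion_insert] at h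
    rcases h.or_of_union with h | h
    · exact ⟨k, Finset.mem_insert_self k K, h⟩
    · obtain ⟨j, hj, hj'⟩ := ih h
      exact ⟨j, Finset.mem_insert_of_mem hj, hj'⟩

theorem IsThick.isPiecewiseSyndetic {A : Set R} (h : IsThick A) : IsPiecewiseSyndetic A := by
  -- There need be no zero to translate by; any element serves.
  obtain ⟨x, -⟩ := h ∅
  classical
  refine ⟨{x}, fun H => ?_⟩
  obtain ⟨y, hy⟩ := h (H.image (x + ·))
  refine ⟨y, fun s hs => ?_⟩
  simpa [setTranslate, add_assoc] using hy (x + s) (Finset.mem_image_of_mem _ hs)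

end Largeness

section Sums

variable {S R : Type*} [AddCommSemigroup S] [AddCommSemigroup R]

theorem exists_coe_eq_add_coe (z : WithZero R) (y : R) : ∃ s : R, (s : WithZero R) = z + y := by
  induction z using WithZero.recZeroCoe with
  | zero => exact ⟨y, (zero_add _).symm⟩
  | coe z => exact ⟨z + y, WithZero.coe_add z y⟩

/-- A finite non-empty sum lies in `S`, and semigroup homomorphisms commute with it. -/
theorem exists_coe_eq_sum {ι : Type*} (a : ι → S) {I : Finset ι} (hI : I.Nonempty) :
    ∃ d : S, ∑ i ∈ I, (a i : WithZero S) = d ∧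
      ∀ φ : S →ₙ+ R, ∑ i ∈ I, (φ (a i) : WithZero R) = φ d := by
  induction hI using Finset.Nonempty.cons_induction with
  | singleton i => exact ⟨a i, by simp, by simp⟩
  | cons i I hi _ ih =>
    obtain ⟨d, hd, hφ⟩ := ih
    refine ⟨a i + d, ?_, fun φ => ?_⟩
    · rw [Finset.sum_cons, hd, WithZero.coe_add]
    · rw [Finset.sum_cons, hφ, map_add, WithZero.coe_add]

theorem finiteSums_comp_equiv_subset {ι κ : Type*} (a : ι → S) (e : κ ≃ ι) :
    finiteSums (a ∘ e) ⊆ finiteSums a := by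
  rintro s ⟨I, hI, hs⟩
  exact ⟨I.map e.toEmbedding, hI.map, by simpa using hs⟩

end Sums

theorem finite_line (α ι : Type*) [Finite α] [Finite ι] : Finite (Line α ι) :=
  Finite.of_injective Line.idxFun fun l l' h => by cases l; cases l'; congr

/-- Along a combinatorial line, the sum of a family of weights splits into a fixed part and the
part contributed by the active coordinates. -/
theorem sum_line_apply {α ι M : Type*} [Fintype ι] [AddCommMonoid M] (l : Line α ι)
    [DecidablePred fun i => l.idxFun i = none] (f : α → ι → M) (x : α) :
    ∑ i, f (l x i) i = ∑ i, (l.idxFun i).elim 0 (fun y => f y i) +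
      ∑ i with l.idxFun i = none, f x i := by
  rw [Finset.sum_filter, ← Finset.sum_add_distrib]
  refine Finset.sum_congr rfl fun i _ => ?_
  rw [Line.coe_apply]
  by_cases h : l.idxFun i = none
  · simp [h]
  · obtain ⟨y, hy⟩ := Option.ne_none_iff_exists'.1 h
    simp [hy]

theorem exists_mem_finiteSums_mem_returnSet {S R ι : Type*} [AddCommSemigroup S]
    [AddCommSemigroup R] [Fintype ι] {n : ℕ} {A : Set R} {F : Finset R}
    (hF : IsThick (⋃ t ∈ F, setTranslate t A))
    (hι : ∀ C : (ι → Fin n) → F, ∃ l : Line (Fin n) ι, l.IsMono C)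
    (φ : Fin n → (S →ₙ+ R)) (a : ι → S) : (finiteSums a ∩ returnSet A φ).Nonempty := by
  classical
  have := finite_line (Fin n) ι
  have := Fintype.ofFinite (Line (Fin n) ι)
  let I (l : Line (Fin n) ι) : Finset ι := {i | l.idxFun i = none}
  have hI (l : Line (Fin n) ι) : (I l).Nonempty :=
    l.proper.imp fun i hi => by simpa [I] using hi
  choose d hd hφd using fun l => exists_coe_eq_sum (R := R) a (hI l)
  -- The fixed part; it is zero if every coordinate is active, hence `WithZero`.
  let c (l : Line (Fin n) ι) : WithZero R :=
    ∑ i, (l.idxFun i).elim 0 fun k => (φ k (a i) : WithZero R)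
  have hc (l : Line (Fin n) ι) (j : Fin n) :
      ∑ i, (φ (l j i) (a i) : WithZero R) = c l + φ j (d l) := by
    rw [sum_line_apply l (fun k i => (φ k (a i) : WithZero R)), ← hφd]
  choose q hq using fun (w : ι → Fin n) (y : R) =>
    exists_coe_eq_add_coe (∑ i, (φ (w i) (a i) : WithZero R)) y
  choose u hu using fun (l : Line (Fin n) ι) (t : R) => exists_coe_eq_add_coe (c l) t
  let B (k : Line (Fin n) ι × F) : Set R :=
    setTranslate (u k.1 k.2) (⋂ j, setTranslate (φ j (d k.1)) A)
  have hB : IsThick (⋃ k ∈ (Finset.univ : Finset (Line (Fin n) ι × F)), B k) := by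
    intro G
    obtain ⟨x, hx⟩ := hF ((Finset.univ ×ˢ G).image fun p => q p.1 p.2)
    refine ⟨x, fun g hg => ?_⟩
    have hcol (w : ι → Fin n) : ∃ t : F, (t : R) + (q w g + x) ∈ A := by
      have := hx (q w g)
        (Finset.mem_image.2 ⟨(w, g), Finset.mem_product.2 ⟨Finset.mem_univ _, hg⟩, rfl⟩)
      simp only [Set.mem_iUnion, exists_prop] at this
      obtain ⟨t, ht, h⟩ := this
      exact ⟨⟨t, ht⟩, h⟩
    -- The colouring depends on `g` and `x`, but the dimension `ι` does not.
    choose C hC using hcol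
    obtain ⟨l, t, hl⟩ := hι C
    refine Set.mem_biUnion (Finset.mem_univ (l, t)) (Set.mem_iInter.2 fun j => ?_)
    have h := hC (l j)
    rw [hl j] at h
    have key : (t : R) + (q (l j) g + x) = φ j (d l) + (u l t + (g + x)) := by
      apply WithZero.coe_injective
      simp only [WithZero.coe_add, hq, hu, hc]
      abel
    rw [key] at h
    exact h
  obtain ⟨k, -, hk⟩ := hB.isPiecewiseSyndetic.exists_of_biUnion
  exact ⟨d k.1, ⟨I k.1, hI k.1, hd k.1⟩, hk.of_setTranslate⟩

end SemigroupLargeness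

theorem mainTheorem2 {S R : Type*} [AddCommSemigroup S] [AddCommSemigroup R] (A : Set R)
    (hA : SemigroupLargeness.IsPiecewiseSyndetic A) (n : ℕ) :
    ∃ r : ℕ, ∀ φ : Fin n → (S →ₙ+ R),
      SemigroupLargeness.IsIPStar r (SemigroupLargeness.returnSet A φ) := by
  obtain ⟨F, hF⟩ := hA
  obtain ⟨ι, _, hι⟩ := Combinatorics.Line.exists_mono_in_high_dimension (Fin n) F
  refine ⟨Fintype.card ι, fun φ a => ?_⟩
  exact (SemigroupLargeness.exists_mem_finiteSums_mem_returnSet hF hι φ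
    (a ∘ Fintype.equivFin ι)).mono
    (Set.inter_subset_inter_left _ (SemigroupLargeness.finiteSums_comp_equiv_subset a _))
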